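/- Let $n\ge 1$ and $d_1,\dots,d_n\ge 1$ be integers and let $M$ be an arbitrary complex $(d_1\cdots d_n)\times(d_1\cdots d_n)$ matrix, regarded as an element of $M_{d_1}(\mathbb{C})\otimes\cdots\otimes M_{d_n}(\mathbb{C})$, with rows and columns indexed by tuples $k=(k_1,\dots,k_n)$, $1\le k_j\le d_j$. For $1\le i\le n$ let $M_i\in M_{d_i}(\mathbb{C})$ be the $i$-th partial trace of $M$, obtained by tracing out all tensor factors except the $i$-th: $$(M_i)_{ab}=\sum_{(k_j)_{j\ne i}} M_{(k_1,\dots,k_{i-1},a,k_{i+1},\dots,k_n),\,(k_1,\dots,k_{i-1},b,k_{i+1},\dots,k_n)}.$$ For $p\in[1,\infty]$ let $\|\cdot\|_p$ be the Schatten $p$-norm, i.e. the $\ell_p$-norm of the vector of singular values. Then for every $p\in[1,\infty]$ $$\sum_{i=1}^n\|M_i\|_p\;\le\;(n-1)\,\|M\|_1+\|M\|_p .$$ -/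

import Mathlib

open scoped ENNReal

/-- The Schatten `p`-norm of a square complex matrix: the `ℓ^p`-norm of the vector of its singular
values, listed with multiplicity. For `p = ∞` this is the largest singular value. -/
noncomputable def schattenNorm {ι : Type*} [Fintype ι] [DecidableEq ι]
    (p : ℝ≥0∞) (A : Matrix ι ι ℂ) : ℝ :=
  ‖(WithLp.toLp p fun k : Fin (Fintype.card ι) =>
    (Matrix.toEuclideanLin A).singularValues k : PiLp p fun _ : Fin (Fintype.card ι) => ℝ)‖

/-- The `i`-th partial trace `M_i` of a matrix `M` on the tensor product of the spaces `ℂ^(d j)`,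
whose standard basis is indexed by tuples `k` with `k j : Fin (d j)`. All tensor factors
except the `i`-th one are traced out: `(M_i) a b` is the sum, over all values of the coordinates
`j ≠ i`, of the entries of `M` whose row and column tuples share these coordinates and have
`i`-th coordinate `a` and `b`, respectively. -/
def partialTrace {n : ℕ} {d : Fin n → ℕ}
    (M : Matrix ((j : Fin n) → Fin (d j)) ((j : Fin n) → Fin (d j)) ℂ) (i : Fin n) :
    Matrix (Fin (d i)) (Fin (d i)) ℂ :=
  Matrix.of fun a b => ∑ k : ((j : Fin n) → Fin (d j)) with k i = a, M k (Function.update k i b)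

/-!
The inequality is reduced by duality to an operator inequality for commuting matrices, which in
coordinates is a statement about numbers in `[0, 1]`.

Let `M = U diag(s) Vᴴ` and `M_i = X_i diag(σ_i) Y_iᴴ` be singular value decompositions, and let `q`
be the exponent conjugate to `p`. Choose nonnegative vectors `b_i` in the unit ball of `ℓ^q` with
`∑ a, b_i a * σ_i a = ‖M_i‖ₚ` (`exists_isNonnegUnitBall_sum_mul_eq`). The left-hand side is then
`∑ i, ∑ a, b_i a * (X_iᴴ M_i Y_i) a a`. Each diagonal entry is a sum over the singular vectors
`u_j, v_j` of `M` of inner products that involve `X_i` and `Y_i` in the `i`-th factor and the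
standard basis in the others. Applying `|z w| ≤ (|z|² + |w|²) / 2` separates the `U`-part from
the `V`-part, and in each part alone the standard basis in the traced out factors may be replaced
by any other basis (`sum_sum_mul_norm_sq_congr`). This yields a bound by the product bases
`X = ⊗ X_i` and `Y = ⊗ Y_i` (`re_partialTrace_le`), so that the whole sum is at most the average
of `∑ k, (∑ i, b_i (k_i)) * ∑ j, s_j * |⟨X_k, u_j⟩|²` and the same expression for `Y` and `V`.

Since `0 ≤ b_i ≤ 1`, Weierstrass' product inequality (`sum_le_card_sub_one_add_prod`) gives
`∑ i, b_i (k_i) ≤ (n - 1) + ∏ i, b_i (k_i)`. The matrix `|⟨X_k, u_j⟩|²` is doubly stochastic, hence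
the constant `n - 1` contributes `(n - 1) * ‖M‖₁`. The tensor product of the `b_i` lies in the unit
ball of `ℓ^q`, which doubly stochastic matrices preserve by Jensen's inequality, so by Hölder's
inequality the product term contributes at most `‖M‖ₚ` (`sum_mul_sum_mul_norm_sq_le`).
-/

open Matrix

/-! ### Nonnegative vectors in the unit ball of `ℓ^q` -/

/-- The vector `b` is nonnegative and lies in the unit ball of `ℓ^q`. For finite `q` the norm
condition is stated on the sum of `q`-th powers; for every `q` the bound `b a ≤ 1`, which is the
whole condition when `q = ∞`, is recorded separately. -/
structure IsNonnegUnitBall {ι : Type*} [Fintype ι] (q : ℝ≥0∞) (b : ι → ℝ) : Prop where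
  nonneg : ∀ a, 0 ≤ b a
  le_one : ∀ a, b a ≤ 1
  sum_rpow_le_one : q ≠ ∞ → ∑ a, b a ^ q.toReal ≤ 1

lemma toReal_one_le_of_ne_top {q : ℝ≥0∞} (hq : 1 ≤ q) (hq' : q ≠ ∞) : 1 ≤ q.toReal := by
  simpa using ENNReal.toReal_mono hq' hq

lemma IsNonnegUnitBall.of_sum_rpow_le_one {ι : Type*} [Fintype ι] {q : ℝ≥0∞} {b : ι → ℝ}
    (hq : 1 ≤ q) (hq' : q ≠ ∞) (hb : ∀ a, 0 ≤ b a) (hsum : ∑ a, b a ^ q.toReal ≤ 1) :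
    IsNonnegUnitBall q b := by
  refine ⟨hb, fun a => ?_, fun _ => hsum⟩
  have hr := toReal_one_le_of_ne_top hq hq'
  have h : b a ^ q.toReal ≤ 1 :=
    (Finset.single_le_sum (f := fun a => b a ^ q.toReal)
      (fun i _ => Real.rpow_nonneg (hb i) _) (Finset.mem_univ a)).trans hsum
  by_contra! hlt
  exact h.not_gt (Real.one_lt_rpow hlt (by linarith))

/-- The `ℓ^p`-norm of a nonnegative vector is attained by pairing it with a nonnegative vector of
the unit ball of the dual norm. -/
lemma exists_isNonnegUnitBall_sum_mul_eq {ι : Type*} [Fintype ι] (p q : ℝ≥0∞)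
    [hpq : p.HolderConjugate q] (s : ι → ℝ) (hs : ∀ a, 0 ≤ s a) :
    ∃ b : ι → ℝ, IsNonnegUnitBall q b ∧
      ∑ a, b a * s a = ‖(WithLp.toLp p s : PiLp p fun _ : ι => ℝ)‖ := by
  classical
  have hq1 : 1 ≤ q := ENNReal.HolderConjugate.one_le q p
  by_cases hq : q = ∞
  · have hp : p = 1 := (ENNReal.HolderConjugate.eq_top_iff_eq_one q p).1 hq
    subst hq hp
    refine ⟨fun _ => 1, ⟨fun _ => zero_le_one, fun _ => le_rfl, fun h => absurd rfl h⟩, ?_⟩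
    rw [PiLp.norm_eq_sum (by simp)]
    simp [abs_of_nonneg (hs _)]
  by_cases hp : p = ∞
  · have hq' : q = 1 := (ENNReal.HolderConjugate.eq_top_iff_eq_one p q).1 hp
    subst hq' hp
    rw [PiLp.norm_eq_ciSup]
    rcases isEmpty_or_nonempty ι with h | h
    · exact ⟨fun _ => 0, ⟨fun _ => le_rfl, fun _ => zero_le_one, by simp⟩, by simp⟩
    · -- The norm is the largest entry; pair with the corresponding standard basis vector.
      obtain ⟨m, hm⟩ := exists_eq_ciSup_of_finite (f := fun i => ‖s i‖)
      refine ⟨Pi.single m 1, .of_sum_rpow_le_one le_rfl hq (fun a => ?_) ?_, ?_⟩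
      · by_cases ha : a = m <;> simp [ha]
      · simp
      · simp only [← hm]
        simp [Pi.single_apply, abs_of_nonneg (hs m)]
  have hc : p.toReal.HolderConjugate q.toReal := ENNReal.HolderConjugate.toReal_of_ne_top hp hq
  lift s to ι → NNReal using hs
  obtain ⟨b, hb, hbs⟩ := (NNReal.isGreatest_Lp Finset.univ s hc).1
  refine ⟨fun a => b a, .of_sum_rpow_le_one hq1 hq (fun a => (b a).2) ?_, ?_⟩
  · exact_mod_cast hb
  · rw [PiLp.norm_eq_sum hc.pos]
    simp only [Real.norm_eq_abs, NNReal.abs_eq]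
    simp only at hbs
    simp_rw [mul_comm (s _)] at hbs
    exact_mod_cast hbs

/-- Hölder's inequality against a vector of the unit ball of the dual norm. -/
lemma IsNonnegUnitBall.sum_mul_le_norm {ι : Type*} [Fintype ι] {p q : ℝ≥0∞}
    [hpq : p.HolderConjugate q] {b : ι → ℝ} (hb : IsNonnegUnitBall q b) (s : ι → ℝ)
    (hs : ∀ a, 0 ≤ s a) :
    ∑ a, s a * b a ≤ ‖(WithLp.toLp p s : PiLp p fun _ : ι => ℝ)‖ := by
  by_cases hq : q = ∞
  · have hp : p = 1 := (ENNReal.HolderConjugate.eq_top_iff_eq_one q p).1 hq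
    subst hq hp
    rw [PiLp.norm_eq_sum (by simp)]
    simp only [ENNReal.toReal_one, Real.rpow_one, Real.norm_eq_abs, abs_of_nonneg (hs _), div_one]
    exact Finset.sum_le_sum fun a _ => mul_le_of_le_one_right (hs a) (hb.le_one a)
  by_cases hp : p = ∞
  · have hq' : q = 1 := (ENNReal.HolderConjugate.eq_top_iff_eq_one p q).1 hp
    subst hq' hp
    set N := ‖(WithLp.toLp ∞ s : PiLp ∞ fun _ : ι => ℝ)‖ with hN
    have hle : ∀ a, s a ≤ N := fun a =>
      (le_abs_self _).trans (PiLp.norm_apply_le (WithLp.toLp ∞ s : PiLp ∞ fun _ : ι => ℝ) a)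
    have hsum : ∑ a, b a ≤ 1 := by simpa using hb.sum_rpow_le_one hq
    calc ∑ a, s a * b a ≤ ∑ a, N * b a :=
          Finset.sum_le_sum fun a _ => mul_le_mul_of_nonneg_right (hle a) (hb.nonneg a)
      _ = N * ∑ a, b a := by rw [Finset.mul_sum]
      _ ≤ N := mul_le_of_le_one_right (norm_nonneg _) hsum
  have hc : p.toReal.HolderConjugate q.toReal := ENNReal.HolderConjugate.toReal_of_ne_top hp hq
  refine (Real.inner_le_Lp_mul_Lq_of_nonneg Finset.univ hc (fun a _ => hs a)
    (fun a _ => hb.nonneg a)).trans ?_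
  rw [PiLp.norm_eq_sum hc.pos]
  simp only [Real.norm_eq_abs, abs_of_nonneg (hs _)]
  refine mul_le_of_le_one_right
    (Real.rpow_nonneg (Finset.sum_nonneg fun a _ => Real.rpow_nonneg (hs a) _) _) ?_
  exact Real.rpow_le_one (Finset.sum_nonneg fun a _ => Real.rpow_nonneg (hb.nonneg a) _)
    (hb.sum_rpow_le_one hq) (one_div_nonneg.2 hc.symm.nonneg)

/-- The tensor product of vectors of unit balls of `ℓ^q` lies in the unit ball of `ℓ^q`. -/
lemma IsNonnegUnitBall.prod {ι : Type*} [Fintype ι] [DecidableEq ι] {κ : ι → Type*}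
    [∀ i, Fintype (κ i)] {q : ℝ≥0∞} {b : ∀ i, κ i → ℝ} (hb : ∀ i, IsNonnegUnitBall q (b i)) :
    IsNonnegUnitBall q (fun k : ∀ i, κ i => ∏ i, b i (k i)) where
  nonneg k := Finset.prod_nonneg fun i _ => (hb i).nonneg _
  le_one k := Finset.prod_le_one (fun i _ => (hb i).nonneg _) fun i _ => (hb i).le_one _
  sum_rpow_le_one hq := by
    simp_rw [← Real.finsetProd_rpow _ _ fun i _ => (hb i).nonneg _]
    rw [← Fintype.prod_sum fun i a => b i a ^ q.toReal]
    exact Finset.prod_le_one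
      (fun i _ => Finset.sum_nonneg fun a _ => Real.rpow_nonneg ((hb i).nonneg a) _)
      fun i _ => (hb i).sum_rpow_le_one hq

/-- A doubly stochastic matrix preserves the unit ball of `ℓ^q`, by Jensen's inequality. -/
lemma IsNonnegUnitBall.sum_mul {ι κ : Type*} [Fintype ι] [Fintype κ] {q : ℝ≥0∞} (hq1 : 1 ≤ q)
    {b : κ → ℝ} (hb : IsNonnegUnitBall q b) {D : κ → ι → ℝ} (hD : ∀ k j, 0 ≤ D k j)
    (hcol : ∀ j, ∑ k, D k j = 1) (hrow : ∀ k, ∑ j, D k j = 1) :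
    IsNonnegUnitBall q (fun j => ∑ k, D k j * b k) where
  nonneg j := Finset.sum_nonneg fun k _ => mul_nonneg (hD k j) (hb.nonneg k)
  le_one j := (hcol j) ▸ Finset.sum_le_sum fun k _ =>
    mul_le_of_le_one_right (hD k j) (hb.le_one k)
  sum_rpow_le_one hq := calc
    ∑ j, (∑ k, D k j * b k) ^ q.toReal ≤ ∑ j, ∑ k, D k j * b k ^ q.toReal :=
      Finset.sum_le_sum fun j _ => Real.rpow_arith_mean_le_arith_mean_rpow _ _ _
        (fun k _ => hD k j) (hcol j) (fun k _ => hb.nonneg k) (toReal_one_le_of_ne_top hq1 hq)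
    _ = ∑ k, b k ^ q.toReal := by
      rw [Finset.sum_comm]
      simp_rw [← Finset.sum_mul, hrow, one_mul]
    _ ≤ 1 := hb.sum_rpow_le_one hq

/-- Weierstrass' product inequality, with an upper bound for the sum of numbers in `[0, 1]`. -/
lemma sum_le_card_sub_one_add_prod {ι : Type*} (s : Finset ι) {b : ι → ℝ}
    (h0 : ∀ i, 0 ≤ b i) (h1 : ∀ i, b i ≤ 1) :
    ∑ i ∈ s, b i ≤ ((s.card : ℝ) - 1) + ∏ i ∈ s, b i := by
  classical
  induction s using Finset.induction_on with
  | empty => simp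
  | insert i s hi ih =>
    rw [Finset.sum_insert hi, Finset.prod_insert hi, Finset.card_insert_of_notMem hi]
    push_cast
    have hp1 : ∏ j ∈ s, b j ≤ 1 := Finset.prod_le_one (fun j _ => h0 j) fun j _ => h1 j
    nlinarith [mul_nonneg (sub_nonneg.2 (h1 i)) (sub_nonneg.2 hp1)]

/-! ### Singular value decomposition -/

/-- Singular value decomposition of a linear map: the right singular vectors are eigenvectors of
`T† T`, and the left ones are their normalized images under `T`, completed to a basis. -/
lemma LinearMap.exists_orthonormalBasis_apply_eq_singularValues {E : Type*} [NormedAddCommGroup E]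
    [InnerProductSpace ℂ E] [FiniteDimensional ℂ E] (T : E →ₗ[ℂ] E) {N : ℕ}
    (hN : Module.finrank ℂ E = N) :
    ∃ x y : OrthonormalBasis (Fin N) ℂ E, ∀ a, T (y a) = (T.singularValues a : ℂ) • x a := by
  set y := T.isSymmetric_adjoint_comp_self.eigenvectorBasis hN with hy
  have hinner : ∀ a b, inner ℂ (T (y a)) (T (y b)) =
      (T.singularValues b : ℂ) ^ 2 * inner ℂ (y a) (y b) := by
    intro a b
    have h := T.isSymmetric_adjoint_comp_self.apply_eigenvectorBasis hN b
    rw [← T.sq_singularValues_fin hN, ← hy] at h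
    rw [← LinearMap.adjoint_inner_right]
    rw [LinearMap.comp_apply] at h
    rw [h, inner_smul_right]
    simp
  set v : Fin N → E := fun a => ((T.singularValues a : ℂ)⁻¹) • T (y a) with hv
  have hon : Orthonormal ℂ (({a | T.singularValues a ≠ 0} : Set (Fin N)).domRestrict v) := by
    rw [orthonormal_iff_ite]
    rintro ⟨a, ha⟩ ⟨b, hb⟩
    have ha' : (T.singularValues a : ℂ) ≠ 0 := by exact_mod_cast ha
    have hb' : (T.singularValues b : ℂ) ≠ 0 := by exact_mod_cast hb
    simp only [Set.domRestrict_apply, hv, inner_smul_left, inner_smul_right, hinner,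
      orthonormal_iff_ite.1 y.orthonormal, Subtype.mk.injEq, map_inv₀, Complex.conj_ofReal]
    split_ifs with hab
    · subst hab
      field_simp
    · simp
  obtain ⟨x, hx⟩ := hon.exists_orthonormalBasis_extension_of_card_eq (by simp [hN])
  refine ⟨x, y, fun a => ?_⟩
  by_cases ha : T.singularValues a = 0
  -- A vanishing singular value gives `‖T (y a)‖ = 0`, so any completion of the basis works.
  · have h := hinner a a
    rw [ha] at h
    simpa [ha] using h
  · have ha' : (T.singularValues a : ℂ) ≠ 0 := by exact_mod_cast ha
    rw [hx a ha, hv, smul_inv_smul₀ ha']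

/-- The matrix whose columns are the vectors of an orthonormal basis is unitary. -/
lemma OrthonormalBasis.conjTranspose_mul_self_of_apply {ι : Type*} [Fintype ι] [DecidableEq ι]
    (x : OrthonormalBasis ι ℂ (EuclideanSpace ℂ ι)) :
    (Matrix.of fun i a => x a i)ᴴ * (Matrix.of fun i a => x a i) = 1 := by
  ext a b
  rw [Matrix.mul_apply, Matrix.one_apply, ← orthonormal_iff_ite.1 x.orthonormal a b]
  simp [PiLp.inner_apply, mul_comm]

/-- Singular value decomposition of a square complex matrix, with singular values indexed by the
index type of the matrix. -/
lemma Matrix.exists_singularValueDecomposition {ι : Type*} [Fintype ι] [DecidableEq ι]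
    (A : Matrix ι ι ℂ) :
    ∃ (U V : Matrix ι ι ℂ) (s : ι → ℝ), Uᴴ * U = 1 ∧ Vᴴ * V = 1 ∧ (∀ a, 0 ≤ s a) ∧
      A = U * diagonal (fun a => (s a : ℂ)) * Vᴴ ∧
      ∀ p : ℝ≥0∞, 1 ≤ p →
        schattenNorm p A = ‖(WithLp.toLp p s : PiLp p fun _ : ι => ℝ)‖ := by
  obtain ⟨x, y, hxy⟩ := (toEuclideanLin A).exists_orthonormalBasis_apply_eq_singularValues
    (finrank_euclideanSpace (ι := ι) (𝕜 := ℂ))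
  set e := Fintype.equivFin ι
  set x' := x.reindex e.symm with hx'
  set y' := y.reindex e.symm with hy'
  set U : Matrix ι ι ℂ := Matrix.of fun i a => x' a i with hU
  set V : Matrix ι ι ℂ := Matrix.of fun i a => y' a i with hV
  set s : ι → ℝ := fun a => (toEuclideanLin A).singularValues (e a) with hs
  have hVV : V * Vᴴ = 1 := mul_eq_one_comm.1 y'.conjTranspose_mul_self_of_apply
  have hAV : A * V = U * diagonal (fun a => (s a : ℂ)) := by
    ext i a
    have h := congrArg (fun w : EuclideanSpace ℂ ι => w i) (hxy (e a))
    rw [Matrix.mul_diagonal]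
    simp only [Matrix.toLpLin_apply, PiLp.smul_apply, smul_eq_mul] at h
    simp only [hU, hV, hs, hx', hy', Matrix.mul_apply, Matrix.of_apply,
      OrthonormalBasis.reindex_apply, Equiv.symm_symm]
    rw [mul_comm (x _ _), ← h]
    rfl
  refine ⟨U, V, s, x'.conjTranspose_mul_self_of_apply, y'.conjTranspose_mul_self_of_apply,
    fun a => LinearMap.singularValues_nonneg _ _, ?_, fun p hp => ?_⟩
  · rw [← hAV, Matrix.mul_assoc, hVV, Matrix.mul_one]
  · have : Fact (1 ≤ p) := ⟨hp⟩
    rw [schattenNorm, ← (LinearIsometryEquiv.piLpCongrLeft p ℝ ℝ e.symm).norm_map]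
    rfl

/-! ### Tensor products of matrices and partial traces -/

/-- The tensor product `F 1 ⊗ ⋯ ⊗ F n` of a family of square matrices, with rows and columns
indexed by tuples. -/
def tensorMatrix {n : ℕ} {d : Fin n → ℕ} (F : (j : Fin n) → Matrix (Fin (d j)) (Fin (d j)) ℂ) :
    Matrix ((j : Fin n) → Fin (d j)) ((j : Fin n) → Fin (d j)) ℂ :=
  Matrix.of fun l k => ∏ j, F j (l j) (k j)

lemma tensorMatrix_conjTranspose_mul_self {n : ℕ} {d : Fin n → ℕ}
    {F : (j : Fin n) → Matrix (Fin (d j)) (Fin (d j)) ℂ} (hF : ∀ j, (F j)ᴴ * F j = 1) :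
    (tensorMatrix F)ᴴ * tensorMatrix F = 1 := by
  ext k m
  have h : ∀ j, ∑ c, star (F j c (k j)) * F j c (m j) = if k j = m j then 1 else 0 := by
    intro j
    rw [← Matrix.one_apply, ← hF j, Matrix.mul_apply]
    rfl
  simp only [Matrix.mul_apply, Matrix.conjTranspose_apply, tensorMatrix, Matrix.of_apply,
    star_prod, ← Finset.prod_mul_distrib]
  rw [← Fintype.prod_sum fun j c => star (F j c (k j)) * F j c (m j)]
  simp_rw [h]
  rw [Matrix.one_apply, Finset.prod_ite_zero]
  simp [funext_iff]

/-- Summing over all coordinates of `k` except the `i`-th one, a product of entries of two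
families which are inverse to each other outside `i` forces the remaining coordinates of the
two row tuples to agree. -/
lemma sum_prod_mul_star_eq {n : ℕ} {d : Fin n → ℕ}
    {F G : (j : Fin n) → Matrix (Fin (d j)) (Fin (d j)) ℂ} (i : Fin n)
    (hFG : ∀ j, j ≠ i → G j * (F j)ᴴ = 1) (a : Fin (d i)) (l m : (j : Fin n) → Fin (d j)) :
    ∑ k : ((j : Fin n) → Fin (d j)) with k i = a,
        ∏ j, (star (F j (l j) (k j)) * G j (m j) (k j)) =
      if m = Function.update l i (m i) then star (F i (l i) a) * G i (m i) a else 0 := by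
  have hset : (Finset.univ.filter fun k : ((j : Fin n) → Fin (d j)) => k i = a) =
      Fintype.piFinset (Function.update (fun j => (Finset.univ : Finset (Fin (d j)))) i {a}) := by
    ext k
    simp only [Finset.mem_filter, Finset.mem_univ, true_and, Fintype.mem_piFinset]
    constructor
    · intro hk j
      by_cases hj : j = i
      · subst hj; simp [hk]
      · simp [hj]
    · intro hk
      simpa using hk i
  have hother : ∀ j, j ≠ i → ∑ c, star (F j (l j) c) * G j (m j) c =
      if m j = l j then 1 else 0 := by
    intro j hj
    rw [← Matrix.one_apply, ← hFG j hj, Matrix.mul_apply]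
    exact Finset.sum_congr rfl fun c _ => mul_comm _ _
  rw [hset, ← Finset.prod_univ_sum _ fun j c => star (F j (l j) c) * G j (m j) c,
    ← Finset.mul_prod_erase _ _ (Finset.mem_univ i)]
  have hprod : ∏ j ∈ Finset.univ.erase i,
      ∑ c ∈ Function.update (fun j => (Finset.univ : Finset (Fin (d j)))) i {a} j,
        star (F j (l j) c) * G j (m j) c =
      ∏ j ∈ Finset.univ.erase i, if m j = l j then (1 : ℂ) else 0 := by
    refine Finset.prod_congr rfl fun j hj => ?_
    have hj' := Finset.ne_of_mem_erase hj
    rw [Function.update_of_ne hj', hother j hj']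
  rw [hprod, Finset.prod_ite_zero, Function.update_self, Finset.sum_singleton]
  have hiff : (∀ j ∈ Finset.univ.erase i, m j = l j) ↔ m = Function.update l i (m i) := by
    rw [Function.eq_update_iff]
    simp
  simp only [hiff, mul_ite, Finset.prod_const_one, mul_one, mul_zero]

/-- Partial traces of a matrix compressed on both sides by tensor products: the factors other than
the `i`-th one disappear if they cancel. -/
lemma sum_conjTranspose_tensorMatrix_mul_mul_tensorMatrix {n : ℕ} {d : Fin n → ℕ}
    (M : Matrix ((j : Fin n) → Fin (d j)) ((j : Fin n) → Fin (d j)) ℂ)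
    {F G : (j : Fin n) → Matrix (Fin (d j)) (Fin (d j)) ℂ} (i : Fin n)
    (hFG : ∀ j, j ≠ i → G j * (F j)ᴴ = 1) (a : Fin (d i)) :
    ∑ k : ((j : Fin n) → Fin (d j)) with k i = a,
        ((tensorMatrix F)ᴴ * M * tensorMatrix G) k k =
      ((F i)ᴴ * partialTrace M i * G i) a a := by
  have hL : ∑ k : ((j : Fin n) → Fin (d j)) with k i = a,
        ((tensorMatrix F)ᴴ * M * tensorMatrix G) k k =
      ∑ l, ∑ m, M l m * ∑ k : ((j : Fin n) → Fin (d j)) with k i = a,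
        ∏ j, (star (F j (l j) (k j)) * G j (m j) (k j)) := by
    simp only [Matrix.mul_apply, Matrix.conjTranspose_apply, tensorMatrix, Matrix.of_apply,
      Finset.sum_mul, Finset.mul_sum, Finset.prod_mul_distrib, star_prod]
    rw [Finset.sum_comm]
    conv_rhs => rw [Finset.sum_comm]
    refine Finset.sum_congr rfl fun m _ => ?_
    rw [Finset.sum_comm]
    refine Finset.sum_congr rfl fun l _ => Finset.sum_congr rfl fun k _ => ?_
    ring
  have hR : ((F i)ᴴ * partialTrace M i * G i) a a =
      ∑ l : ((j : Fin n) → Fin (d j)), ∑ b,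
        M l (Function.update l i b) * (star (F i (l i) a) * G i b a) := by
    simp only [Matrix.mul_apply, Matrix.conjTranspose_apply, partialTrace, Matrix.of_apply,
      Finset.sum_mul, Finset.mul_sum]
    rw [← Finset.sum_fiberwise Finset.univ
      (fun l : ((j : Fin n) → Fin (d j)) => l i), Finset.sum_comm]
    refine Finset.sum_congr rfl fun c _ => ?_
    rw [Finset.sum_comm]
    refine Finset.sum_congr rfl fun l hl => Finset.sum_congr rfl fun b _ => ?_
    rw [(Finset.mem_filter.1 hl).2]
    ring
  rw [hL, hR]
  refine Finset.sum_congr rfl fun l _ => ?_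
  simp_rw [sum_prod_mul_star_eq i hFG, mul_ite, mul_zero]
  rw [← Finset.sum_filter]
  refine Finset.sum_bij' (fun m _ => m i) (fun b _ => Function.update l i b) ?_ ?_ ?_ ?_ ?_
  · simp
  · simp
  · intro m hm
    exact (Finset.mem_filter.1 hm).2.symm
  · simp
  · intro m hm
    rw [← (Finset.mem_filter.1 hm).2]

/-! ### Bounding the diagonal entries of partial traces -/

lemma conjTranspose_mul_diagonal_mul_apply {ι : Type*} [Fintype ι] [DecidableEq ι]
    (P Q U V : Matrix ι ι ℂ) (s : ι → ℝ) (k : ι) :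
    (Pᴴ * (U * diagonal (fun j => (s j : ℂ)) * Vᴴ) * Q) k k =
      ∑ j, (s j : ℂ) * ((Pᴴ * U) k j * star ((Qᴴ * V) k j)) := by
  have h : Pᴴ * (U * diagonal (fun j => (s j : ℂ)) * Vᴴ) * Q =
      Pᴴ * U * diagonal (fun j => (s j : ℂ)) * (Qᴴ * V)ᴴ := by
    simp only [conjTranspose_mul, conjTranspose_conjTranspose, Matrix.mul_assoc]
  rw [h, Matrix.mul_apply]
  refine Finset.sum_congr rfl fun j _ => ?_
  rw [Matrix.mul_diagonal, Matrix.conjTranspose_apply]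
  ring

/-- The sum `∑ j, s j * ‖⟨F k, U j⟩‖ ^ 2` over the tuples `k` with `k i = a`, where `F k` are the
columns of a tensor product whose factors other than the `i`-th one are unitary, depends on the
`i`-th factor only. -/
lemma sum_sum_mul_norm_sq_congr {n : ℕ} {d : Fin n → ℕ}
    {F G : (j : Fin n) → Matrix (Fin (d j)) (Fin (d j)) ℂ} {i : Fin n}
    (hF : ∀ j, j ≠ i → F j * (F j)ᴴ = 1) (hG : ∀ j, j ≠ i → G j * (G j)ᴴ = 1) (hFG : F i = G i)
    (U : Matrix ((j : Fin n) → Fin (d j)) ((j : Fin n) → Fin (d j)) ℂ)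
    (s : ((j : Fin n) → Fin (d j)) → ℝ) (a : Fin (d i)) :
    ∑ k : ((j : Fin n) → Fin (d j)) with k i = a,
        ∑ j, s j * ‖((tensorMatrix F)ᴴ * U) k j‖ ^ 2 =
      ∑ k : ((j : Fin n) → Fin (d j)) with k i = a,
        ∑ j, s j * ‖((tensorMatrix G)ᴴ * U) k j‖ ^ 2 := by
  -- Both sides are the `(a, a)` entry of the compressed partial trace of `U * diagonal s * Uᴴ`.
  have key := (sum_conjTranspose_tensorMatrix_mul_mul_tensorMatrix
    (U * diagonal (fun j => (s j : ℂ)) * Uᴴ) i hF a)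
  rw [hFG, ← sum_conjTranspose_tensorMatrix_mul_mul_tensorMatrix _ i hG a] at key
  simp only [conjTranspose_mul_diagonal_mul_apply, RCLike.star_def, Complex.mul_conj'] at key
  exact_mod_cast key

/-- The diagonal entries of a partial trace of `U * diagonal s * Vᴴ` with respect to two
orthonormal bases are bounded by averages over tensor products of these bases. The bases in the
other factors are arbitrary and may differ for `U` and `V`. -/
lemma re_partialTrace_le {n : ℕ} {d : Fin n → ℕ}
    {X Y : (j : Fin n) → Matrix (Fin (d j)) (Fin (d j)) ℂ}
    (hX : ∀ j, (X j)ᴴ * X j = 1) (hY : ∀ j, (Y j)ᴴ * Y j = 1)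
    (U V : Matrix ((j : Fin n) → Fin (d j)) ((j : Fin n) → Fin (d j)) ℂ)
    {s : ((j : Fin n) → Fin (d j)) → ℝ} (hs : ∀ j, 0 ≤ s j) (i : Fin n) (a : Fin (d i)) :
    (((X i)ᴴ * partialTrace (U * diagonal (fun j => (s j : ℂ)) * Vᴴ) i * Y i) a a).re ≤
      ∑ k : ((j : Fin n) → Fin (d j)) with k i = a, ∑ j, s j *
        ((‖((tensorMatrix X)ᴴ * U) k j‖ ^ 2 + ‖((tensorMatrix Y)ᴴ * V) k j‖ ^ 2) / 2) := by
  -- A common basis has to be used for `U` and `V` in the traced out factors: the standard one.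
  set F := Function.update (fun j => (1 : Matrix (Fin (d j)) (Fin (d j)) ℂ)) i (X i) with hF
  set G := Function.update (fun j => (1 : Matrix (Fin (d j)) (Fin (d j)) ℂ)) i (Y i) with hG
  have hF1 : ∀ j, j ≠ i → F j = 1 := fun j hj => Function.update_of_ne hj _ _
  have hG1 : ∀ j, j ≠ i → G j = 1 := fun j hj => Function.update_of_ne hj _ _
  have hFi : F i = X i := Function.update_self _ _ _
  have hGi : G i = Y i := Function.update_self _ _ _
  rw [← hFi, ← hGi, ← sum_conjTranspose_tensorMatrix_mul_mul_tensorMatrix _ i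
    (fun j hj => by simp [hF1 j hj, hG1 j hj]) a]
  have hsX := sum_sum_mul_norm_sq_congr (F := F) (G := X) (fun j hj => by simp [hF1 j hj])
    (fun j _ => mul_eq_one_comm.1 (hX j)) hFi U s a
  have hsY := sum_sum_mul_norm_sq_congr (F := G) (G := Y) (fun j hj => by simp [hG1 j hj])
    (fun j _ => mul_eq_one_comm.1 (hY j)) hGi V s a
  have hsplit : ∀ P Q : Matrix ((j : Fin n) → Fin (d j)) ((j : Fin n) → Fin (d j)) ℂ,
      ∑ k : ((j : Fin n) → Fin (d j)) with k i = a, ∑ j, s j *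
        ((‖P k j‖ ^ 2 + ‖Q k j‖ ^ 2) / 2) =
      ((∑ k : ((j : Fin n) → Fin (d j)) with k i = a, ∑ j, s j * ‖P k j‖ ^ 2) +
        ∑ k : ((j : Fin n) → Fin (d j)) with k i = a, ∑ j, s j * ‖Q k j‖ ^ 2) / 2 := by
    intro P Q
    simp only [← Finset.sum_add_distrib, Finset.sum_div]
    refine Finset.sum_congr rfl fun k _ => Finset.sum_congr rfl fun j _ => ?_
    ring
  rw [hsplit, ← hsX, ← hsY, ← hsplit, Complex.re_sum]
  refine Finset.sum_le_sum fun k _ => ?_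
  rw [conjTranspose_mul_diagonal_mul_apply, Complex.re_sum]
  refine Finset.sum_le_sum fun j _ => ?_
  rw [Complex.re_ofReal_mul]
  refine mul_le_mul_of_nonneg_left ?_ (hs j)
  refine (Complex.re_le_norm _).trans ?_
  rw [norm_mul, norm_star]
  linarith [two_mul_le_add_sq ‖((tensorMatrix F)ᴴ * U) k j‖ ‖((tensorMatrix G)ᴴ * V) k j‖]

/-! ### The inequality for Schatten norms -/

/-- The squared absolute values of the entries of a unitary matrix have row sums `1`. -/
lemma sum_norm_sq_eq_one_of_mul_conjTranspose {ι : Type*} [Fintype ι] [DecidableEq ι]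
    {W : Matrix ι ι ℂ} (hW : W * Wᴴ = 1) (k : ι) : ∑ j, ‖W k j‖ ^ 2 = 1 := by
  have h := congrFun (congrFun hW k) k
  simp only [Matrix.mul_apply, Matrix.conjTranspose_apply, RCLike.star_def, Complex.mul_conj',
    Matrix.one_apply_eq] at h
  exact_mod_cast h

/-- If `c k ≤ n - 1 + β k` with `β` in the unit ball of `ℓ^q`, then averaging `c` against the
doubly stochastic matrix `‖W k j‖ ^ 2` and pairing with `s` gives at most
`(n - 1) * ‖s‖₁ + ‖s‖ₚ`. -/
lemma sum_mul_sum_mul_norm_sq_le {ι : Type*} [Fintype ι] [DecidableEq ι] {p q : ℝ≥0∞}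
    [hpq : p.HolderConjugate q] {W : Matrix ι ι ℂ} (hW : Wᴴ * W = 1) {c β : ι → ℝ} {t : ℝ}
    (hβ : IsNonnegUnitBall q β) (hc : ∀ k, c k ≤ t + β k) {s : ι → ℝ} (hs : ∀ j, 0 ≤ s j) :
    ∑ k, c k * ∑ j, s j * ‖W k j‖ ^ 2 ≤
      t * ‖(WithLp.toLp 1 s : PiLp 1 fun _ : ι => ℝ)‖ +
        ‖(WithLp.toLp p s : PiLp p fun _ : ι => ℝ)‖ := by
  have hcol : ∀ j, ∑ k, ‖W k j‖ ^ 2 = 1 := fun j => by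
    simpa using sum_norm_sq_eq_one_of_mul_conjTranspose (W := Wᴴ) (by simpa using hW) j
  have hrow := sum_norm_sq_eq_one_of_mul_conjTranspose (mul_eq_one_comm.1 hW)
  have hball := hβ.sum_mul (ENNReal.HolderConjugate.one_le q p)
    (D := fun k j => ‖W k j‖ ^ 2) (fun k j => sq_nonneg _) hcol hrow
  have h1 : ‖(WithLp.toLp 1 s : PiLp 1 fun _ : ι => ℝ)‖ = ∑ j, s j := by
    rw [PiLp.norm_eq_sum (by simp)]
    simp [abs_of_nonneg (hs _)]
  calc ∑ k, c k * ∑ j, s j * ‖W k j‖ ^ 2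
      ≤ ∑ k, (t + β k) * ∑ j, s j * ‖W k j‖ ^ 2 :=
        Finset.sum_le_sum fun k _ => mul_le_mul_of_nonneg_right (hc k)
          (Finset.sum_nonneg fun j _ => mul_nonneg (hs j) (sq_nonneg _))
    _ = t * ∑ j, s j + ∑ j, s j * ∑ k, ‖W k j‖ ^ 2 * β k := by
        have ht : ∑ j, s j = ∑ k, ∑ j, s j * ‖W k j‖ ^ 2 := by
          rw [Finset.sum_comm]
          simp_rw [← Finset.mul_sum, hcol, mul_one]
        rw [ht]
        simp_rw [add_mul, Finset.sum_add_distrib, Finset.mul_sum]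
        congr 1
        rw [Finset.sum_comm]
        refine Finset.sum_congr rfl fun j _ => Finset.sum_congr rfl fun k _ => ?_
        ring
    _ ≤ _ := by
        rw [h1]
        exact add_le_add le_rfl (hball.sum_mul_le_norm (p := p) s hs)

theorem mainTheorem1 (n : ℕ) (d : Fin n → ℕ)
    (M : Matrix ((j : Fin n) → Fin (d j)) ((j : Fin n) → Fin (d j)) ℂ)
    (p : ℝ≥0∞) (hp : 1 ≤ p) :
    ∑ i : Fin n, schattenNorm p (partialTrace M i) ≤
      ((n : ℝ) - 1) * schattenNorm 1 M + schattenNorm p M := by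
  set q := p.conjExponent
  have hpq : p.HolderConjugate q := .conjExponent hp
  obtain ⟨U, V, s, hU, hV, hs, hM, hnorm⟩ := M.exists_singularValueDecomposition
  choose X Y σ hX hY hσ hMi hnormi using
    fun i => (partialTrace M i).exists_singularValueDecomposition
  choose b hb hbσ using fun i => exists_isNonnegUnitBall_sum_mul_eq p q (σ i) (hσ i)
  have hentry : ∀ i a, σ i a = (((X i)ᴴ * partialTrace M i * Y i) a a).re := by
    intro i a
    have h : (X i)ᴴ * partialTrace M i * Y i = diagonal (fun a => (σ i a : ℂ)) := by
      rw [hMi i]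
      calc (X i)ᴴ * (X i * diagonal (fun a => (σ i a : ℂ)) * (Y i)ᴴ) * Y i
          = ((X i)ᴴ * X i) * diagonal (fun a => (σ i a : ℂ)) * ((Y i)ᴴ * Y i) := by
            simp only [Matrix.mul_assoc]
        _ = _ := by rw [hX, hY, Matrix.one_mul, Matrix.mul_one]
    rw [h]
    simp
  set P := (tensorMatrix X)ᴴ * U with hP
  set Q := (tensorMatrix Y)ᴴ * V with hQ
  have hunit : ∀ {Z : (j : Fin n) → Matrix (Fin (d j)) (Fin (d j)) ℂ}
      {W : Matrix ((j : Fin n) → Fin (d j)) ((j : Fin n) → Fin (d j)) ℂ},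
      (∀ j, (Z j)ᴴ * Z j = 1) → Wᴴ * W = 1 →
      ((tensorMatrix Z)ᴴ * W)ᴴ * ((tensorMatrix Z)ᴴ * W) = 1 := by
    intro Z W hZ hW
    have hZ' := mul_eq_one_comm.1 (tensorMatrix_conjTranspose_mul_self hZ)
    calc ((tensorMatrix Z)ᴴ * W)ᴴ * ((tensorMatrix Z)ᴴ * W)
        = Wᴴ * (tensorMatrix Z * (tensorMatrix Z)ᴴ) * W := by
          simp only [conjTranspose_mul, conjTranspose_conjTranspose, Matrix.mul_assoc]
      _ = 1 := by rw [hZ', Matrix.mul_one, hW]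
  set c : ((j : Fin n) → Fin (d j)) → ℝ := fun k => ∑ i, b i (k i) with hc
  have hβ := IsNonnegUnitBall.prod hb
  have hcβ : ∀ k, c k ≤ ((n : ℝ) - 1) + ∏ i, b i (k i) := fun k => by
    simpa using sum_le_card_sub_one_add_prod Finset.univ
      (fun i => (hb i).nonneg (k i)) (fun i => (hb i).le_one (k i))
  have hPle := sum_mul_sum_mul_norm_sq_le (p := p) (hunit hX hU) hβ hcβ hs
  have hQle := sum_mul_sum_mul_norm_sq_le (p := p) (hunit hY hV) hβ hcβ hs
  set T : ((j : Fin n) → Fin (d j)) → ℝ :=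
    fun k => ∑ j, s j * ((‖P k j‖ ^ 2 + ‖Q k j‖ ^ 2) / 2) with hT
  have hTeq : ∑ k, c k * T k = ((∑ k, c k * ∑ j, s j * ‖P k j‖ ^ 2) +
      ∑ k, c k * ∑ j, s j * ‖Q k j‖ ^ 2) / 2 := by
    simp only [hT, ← Finset.sum_add_distrib, Finset.sum_div, Finset.mul_sum]
    refine Finset.sum_congr rfl fun k _ => Finset.sum_congr rfl fun j _ => ?_
    ring
  calc ∑ i, schattenNorm p (partialTrace M i) = ∑ i, ∑ a, b i a * σ i a :=
        Finset.sum_congr rfl fun i _ => by rw [hnormi i p hp, hbσ i]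
    _ ≤ ∑ i, ∑ a, b i a * ∑ k : ((j : Fin n) → Fin (d j)) with k i = a, T k := by
        refine Finset.sum_le_sum fun i _ => Finset.sum_le_sum fun a _ =>
          mul_le_mul_of_nonneg_left ?_ ((hb i).nonneg a)
        rw [hentry, hM]
        exact re_partialTrace_le hX hY U V hs i a
    _ = ∑ i, ∑ k : ((j : Fin n) → Fin (d j)), b i (k i) * T k := by
        refine Finset.sum_congr rfl fun i _ => ?_
        rw [← Finset.sum_fiberwise Finset.univ (fun k : ((j : Fin n) → Fin (d j)) => k i)]
        refine Finset.sum_congr rfl fun a _ => ?_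
        rw [Finset.mul_sum]
        refine Finset.sum_congr rfl fun k hk => ?_
        rw [(Finset.mem_filter.1 hk).2]
    _ = ∑ k, c k * T k := by
        rw [Finset.sum_comm]
        simp_rw [hc, Finset.sum_mul]
    _ ≤ _ := by
        rw [hTeq, hnorm 1 le_rfl, hnorm p hp]
        linarith
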